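/- For $\alpha\in(0,1)$ let $\sigma_\alpha:\mathbb{R}\to\mathbb{R}$, $\sigma_\alpha(x)=\alpha x$ for $x<0$ and $\sigma_\alpha(x)=x$ for $x\ge 0$, and let $\mathcal{F}=\{\sigma_\alpha \mid \alpha\in(0,1)\}$ be the set of true leaky ReLUs. A leaky ReLU feed-forward network from $\mathbb{R}^{d_x}$ to $\mathbb{R}^{d_y}$ is a composition $\phi=\varphi_n\circ W_n\circ\dots\circ\varphi_1\circ W_1$ with $n\ge 1$, where $d_0=d_x$, $d_n=d_y$, $d_1,\dots,d_{n-1}\ge 1$, each $W_i:\mathbb{R}^{d_{i-1}}\to\mathbb{R}^{d_i}$ is affine, and $\varphi_i$ applies to the $k$-th coordinate a function $\sigma^{(i)}_k\in\mathcal{F}$ (which may differ from coordinate to coordinate). Its width is $\max\{d_1,\dots,d_{n-1}\}$ and its minimal interior dimension is $\min\{d_1,\dots,d_{n-1}\}$ if $n>1$; for $n=1$ they are $\max\{d_x,d_y\}$ and $\min\{d_x,d_y\}$. Let $\mathrm{FNN}^{(w,k)}(d_x,d_y)$ be the set of functions given by such networks of width $w$ and minimal interior dimension $k$. For $p\in[1,\infty)$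 and $\mathcal{K}\subset\mathbb{R}^{d_x}$ put $\lVert f\rVert_{\mathcal{K},p}=\left(\int_{\mathcal{K}}\lVert f(x)\rVert_p^p\,dx\right)^{1/p}$. A set $\mathcal{M}$ of functions $\mathbb{R}^{d_x}\to\mathbb{R}^{d_y}$ is an $L^p$ universal approximator of $L^p(\mathbb{R}^{d_x},\mathbb{R}^{d_y})$ if for every $g\in L^p(\mathbb{R}^{d_x},\mathbb{R}^{d_y})$, every compact $\mathcal{K}\subset\mathbb{R}^{d_x}$ and every $\epsilon>0$ there is $f\in\mathcal{M}$ with $\lVert f-g\rVert_{\mathcal{K},p}<\epsilon$. **Theorem.** Let $p\in[1,\infty)$, let $d_x,d_y\ge 1$ be integers and put $w=\max\{2,d_x,d_y\}$. Then $\mathrm{FNN}^{(w,1)}(d_x,d_y)$ is an $L^p$ universal approximator of $L^p(\mathbb{R}^{d_x},\mathbb{R}^{d_y})$; moreover, for every compact $\mathcal{K}\subset\mathbb{R}^{d_x}$, every $f\in L^p(\mathcal{K},\mathbb{R}^{d_y})$ and every $\epsilon>0$ there is $\phi\in\mathrm{FNN}^{(w,1)}(d_x,d_y)$ with $\lVert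 f-\phi\rVert_{\mathcal{K},p}<\epsilon$. Consequently the minimal width for $L^p$ universal approximation of $L^p(\mathbb{R}^{d_x},\mathbb{R}^{d_y})$ by leaky ReLU networks is $w_{\min}=\max\{2,d_x,d_y\}$, i.e. this is the least $v$ such that the leaky ReLU networks of width at most $v$ form an $L^p$ universal approximator; and the minimal interior dimension is $d_{\min}=1$, i.e. $1$ is the least $k$ such that $\mathrm{FNN}^{(w,k)}(d_x,d_y)$ is an $L^p$ universal approximator. -/

import Mathlib

open MeasureTheory
open scoped ENNReal Matrix

/-- The leaky rectified linear unit with slope `α` on the negative half-line. -/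
noncomputable def leakyReLU (α : ℝ) (x : ℝ) : ℝ := if x < 0 then α * x else x

/-- The set `𝓕 = {σ_α | α ∈ (0, 1)}` of true leaky ReLUs. -/
def trueLeakyReLUs : Set (ℝ → ℝ) := {σ | ∃ α : ℝ, 0 < α ∧ α < 1 ∧ σ = leakyReLU α}

/-- A layer `φ ∘ W` from `ℝ^m` to `ℝ^n`: an affine map `W x = M x + b` followed by a componentwise
activation, where every component has its own activation function taken from `A`. -/
structure Layer (A : Set (ℝ → ℝ)) (m n : ℕ) where
  weight : Matrix (Fin n) (Fin m) ℝ
  bias : Fin n → ℝ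
  act : Fin n → ℝ → ℝ
  act_mem : ∀ i, act i ∈ A

/-- The function computed by a layer. -/
def Layer.eval {A : Set (ℝ → ℝ)} {m n : ℕ} (L : Layer A m n) (x : Fin m → ℝ) : Fin n → ℝ :=
  fun i => L.act i ((L.weight *ᵥ x + L.bias) i)

/-- Feed-forward networks `φ_N ∘ W_N ∘ ⋯ ∘ φ_1 ∘ W_1` from `ℝ^m` to `ℝ^n` with activations in `A`:
a network has at least one layer, and all its hidden layers have positive dimension. -/
inductive FNN (A : Set (ℝ → ℝ)) (m : ℕ) : ℕ → Type
  | single {n : ℕ} (L : Layer A m n) : FNN A m n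
  | snoc {k n : ℕ} (φ : FNN A m k) (hk : 0 < k) (L : Layer A k n) : FNN A m n

namespace FNN

/-- The function computed by a network. -/
def eval {A : Set (ℝ → ℝ)} {m : ℕ} : {n : ℕ} → FNN A m n → (Fin m → ℝ) → (Fin n → ℝ)
  | _, single L => L.eval
  | _, snoc φ _ L => fun x => L.eval (φ.eval x)

/-- The list `[d_1, …, d_{N-1}]` of the dimensions of the hidden layers. -/
def hiddenDims {A : Set (ℝ → ℝ)} {m : ℕ} : {n : ℕ} → FNN A m n → List ℕ
  | _, single _ => []
  | _, snoc (k := k) φ _ _ => φ.hiddenDims ++ [k]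

/-- The width: the largest dimension of a hidden layer, or `max {m, n}` if there is no hidden
layer. -/
def width {A : Set (ℝ → ℝ)} {m n : ℕ} (φ : FNN A m n) : ℕ :=
  φ.hiddenDims.max?.getD (max m n)

/-- The minimal interior dimension: the smallest dimension of a hidden layer, or `min {m, n}` if
there is no hidden layer. -/
def minInteriorDim {A : Set (ℝ → ℝ)} {m n : ℕ} (φ : FNN A m n) : ℕ :=
  φ.hiddenDims.min?.getD (min m n)

end FNN

/-- The functions `ℝ^m → ℝ^n` computed by networks with activations in `A` of width at most `w`. -/
def fnnWidthLE (A : Set (ℝ → ℝ)) (m n w : ℕ) : Set ((Fin m → ℝ) → (Fin n → ℝ)) :=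
  {f | ∃ φ : FNN A m n, φ.width ≤ w ∧ φ.eval = f}

/-- The functions `ℝ^m → ℝ^n` computed by networks with activations in `A` of width exactly `w`
and minimal interior dimension exactly `k`. -/
def fnnWidthDim (A : Set (ℝ → ℝ)) (m n w k : ℕ) : Set ((Fin m → ℝ) → (Fin n → ℝ)) :=
  {f | ∃ φ : FNN A m n, φ.width = w ∧ φ.minInteriorDim = k ∧ φ.eval = f}

/-- The norm `‖f‖_{X,p} = (∫_X ‖f(x)‖_p^p dx)^{1/p}`, with the `p`-norm on `ℝ^n` and Lebesgue
measure on `ℝ^m`. -/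
noncomputable def lpNormOn (p : ℝ≥0∞) [Fact (1 ≤ p)] {m n : ℕ} (X : Set (Fin m → ℝ))
    (f : (Fin m → ℝ) → (Fin n → ℝ)) : ℝ≥0∞ :=
  eLpNorm (fun x => WithLp.toLp p (f x)) p (volume.restrict X)

/-- The (representatives of) elements of `L^p(X, ℝ^n)`, for `X ⊆ ℝ^m`. -/
def lpFunctionsOn (p : ℝ≥0∞) [Fact (1 ≤ p)] {m : ℕ} (n : ℕ) (X : Set (Fin m → ℝ)) :
    Set ((Fin m → ℝ) → (Fin n → ℝ)) :=
  {f | MemLp (fun x => WithLp.toLp p (f x)) p (volume.restrict X)}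

/-- `M` is an `L^p` universal approximator of `G`: every `g ∈ G` can be approximated on every
compact set, to every accuracy, by some `f ∈ M`. -/
def IsLpUniversalApproximator (p : ℝ≥0∞) [Fact (1 ≤ p)] {m n : ℕ}
    (M G : Set ((Fin m → ℝ) → (Fin n → ℝ))) : Prop :=
  ∀ g ∈ G, ∀ K : Set (Fin m → ℝ), IsCompact K → ∀ ε : ℝ, 0 < ε →
    ∃ f ∈ M, lpNormOn p K (f - g) < ENNReal.ofReal ε

/-!
Leaky ReLUs with mutually inverse slopes cancel, up to signs, so a stack of layers can compute the
identity exactly on some coordinates while it acts on one of the others. With `w ≥ 2` this makes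
two kinds of maps of `ℝ^w` computable without error by layers of dimension `w`: increasing maps of
a single coordinate that interpolate arbitrary increasing data
(`IsCoord.exists_interpolation`), and shears `x_j ↦ x_j + g(x_i)` whose `g` interpolates
arbitrary data (`IsShear.exists_interpolation`).

*Approximation.* By density it suffices to approximate a uniformly continuous function `g` on a
compact set. Increasing staircases applied to every coordinate tend to the floor function off the
integers, so they collapse the cells of a grid (`IsCoord.exists_tendsto_floor`). Base expansion, a
linear functional, is injective on the vertices of the grid, so that one real number carries the
cell: this is the hidden layer of dimension `1`. A composition of shears then sends finitely many
reals to arbitrary vectors up to a small error (`exists_decoder`): keep the scalar in one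
coordinate, fill in all the others, perturb one of these to be injective on the points, and use it
to overwrite the scalar. The decoder depends on the grid only and not on the steepness of the
staircases, so the networks are uniformly bounded and converge almost everywhere to a step
function close to `g`; bounded convergence gives convergence in `L^p`
(`exists_fnnWidthDim_lpNormOn_sub_lt`). The last activation is injective, and contracts distances,
so it is absorbed by applying its inverse to the target.

*Optimality.* Universal approximation implies approximation in measure on compact sets
(`IsLpUniversalApproximator.exists_volume_lt`). A network of width less than the input dimension
is constant in some direction, so it takes the same values on a ball and on a disjoint translate of
it. If the width is less than the output dimension, the preactivations of the last layer lie in a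
hyperplane with some normal vector `c`, and by monotonicity of the activations the outputs cannot
come close to both `2 s` and `-2 s`, where `s` is the vector of signs of `c`. Networks of width `1`
on `ℝ` are monotone or antitone. Hidden layers have positive dimension by definition, so the
interior dimension `0` does not occur.
-/

/-! ### Networks followed by an affine map -/

lemma Layer.eval_apply {A : Set (ℝ → ℝ)} {m n : ℕ} (L : Layer A m n) (x : Fin m → ℝ) (i : Fin n) :
    L.eval x i = L.act i ((L.weight *ᵥ x + L.bias) i) := rfl

/-- `f` is an affine map applied to the output of a network whose hidden dimensions, together with
its output dimension, form exactly the set `S`. -/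
def Computes (A : Set (ℝ → ℝ)) {m n : ℕ} (S : Set ℕ) (f : (Fin m → ℝ) → (Fin n → ℝ)) : Prop :=
  ∃ (k : ℕ) (φ : FNN A m k) (W : Matrix (Fin n) (Fin k) ℝ) (b : Fin n → ℝ),
    0 < k ∧ {d | d ∈ φ.hiddenDims ∨ d = k} = S ∧ ∀ x, f x = W *ᵥ φ.eval x + b

namespace Computes

lemma single {A : Set (ℝ → ℝ)} {m n : ℕ} (hn : 0 < n) (W : Matrix (Fin n) (Fin m) ℝ)
    (b : Fin n → ℝ) {a : Fin n → ℝ → ℝ} (ha : ∀ i, a i ∈ A) :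
    Computes A {n} (fun (x : Fin m → ℝ) i => a i ((W *ᵥ x + b) i)) := by
  refine ⟨n, FNN.single ⟨W, b, a, ha⟩, 1, 0, hn, ?_, fun x => ?_⟩
  · ext d; simp [FNN.hiddenDims]
  · rw [Matrix.one_mulVec, add_zero]; rfl

lemma affine {A : Set (ℝ → ℝ)} {m n k : ℕ} {S : Set ℕ} {f : (Fin m → ℝ) → (Fin n → ℝ)}
    (hf : Computes A S f) (W : Matrix (Fin k) (Fin n) ℝ) (b : Fin k → ℝ) :
    Computes A S (fun x => W *ᵥ f x + b) := by
  obtain ⟨j, φ, V, c, hj, hS, h⟩ := hf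
  refine ⟨j, φ, W * V, W *ᵥ c + b, hj, hS, fun x => ?_⟩
  simp only [h]
  rw [Matrix.mulVec_add, Matrix.mulVec_mulVec, add_assoc]

lemma act {A : Set (ℝ → ℝ)} {m n : ℕ} {S : Set ℕ} {f : (Fin m → ℝ) → (Fin n → ℝ)}
    (hf : Computes A S f) (hn : 0 < n) {a : Fin n → ℝ → ℝ} (ha : ∀ i, a i ∈ A) :
    Computes A (insert n S) (fun x i => a i (f x i)) := by
  obtain ⟨j, φ, V, c, hj, rfl, h⟩ := hf
  refine ⟨n, φ.snoc hj ⟨V, c, a, ha⟩, 1, 0, hn, ?_, fun x => ?_⟩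
  · ext d; simp [FNN.hiddenDims]; tauto
  · rw [Matrix.one_mulVec, add_zero]; ext i; simp [FNN.eval, Layer.eval, h]

/-- Closing with an activation gives a network with hidden dimensions exactly `1` and `w`. -/
lemma act_mem_fnnWidthDim {A : Set (ℝ → ℝ)} {m n w : ℕ} {f : (Fin m → ℝ) → (Fin n → ℝ)}
    (hw : 1 ≤ w) (hf : Computes A {1, w} f) {a : Fin n → ℝ → ℝ} (ha : ∀ i, a i ∈ A) :
    (fun x i => a i (f x i)) ∈ fnnWidthDim A m n w 1 := by
  obtain ⟨j, φ, V, c, hj, hS, h⟩ := hf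
  have hd (d : ℕ) : d ∈ φ.hiddenDims ++ [j] ↔ d = 1 ∨ d = w := by
    have := Set.ext_iff.1 hS d
    simpa using this
  refine ⟨φ.snoc hj ⟨V, c, a, ha⟩, ?_, ?_, ?_⟩
  · have : (φ.hiddenDims ++ [j]).max? = some w := by
      rw [List.max?_eq_some_iff]
      refine ⟨(hd w).2 (Or.inr rfl), fun d h => ?_⟩
      rcases (hd d).1 h with rfl | rfl <;> omega
    simp only [FNN.width, FNN.hiddenDims, this, Option.getD_some]
  · have : (φ.hiddenDims ++ [j]).min? = some 1 := by
      rw [List.min?_eq_some_iff]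
      refine ⟨(hd 1).2 (Or.inl rfl), fun d h => ?_⟩
      rcases (hd d).1 h with rfl | rfl <;> omega
    simp only [FNN.minInteriorDim, FNN.hiddenDims, this, Option.getD_some]
  · funext x i; simp [FNN.eval, Layer.eval, h]

end Computes

/-- Compositions of affine self-maps of `ℝ^w` and componentwise applications of activations
in `A`. -/
inductive IsStack (A : Set (ℝ → ℝ)) (w : ℕ) : ((Fin w → ℝ) → (Fin w → ℝ)) → Prop
  | affine (W : Matrix (Fin w) (Fin w) ℝ) (b : Fin w → ℝ) : IsStack A w (fun x => W *ᵥ x + b)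
  | act (a : Fin w → ℝ → ℝ) (ha : ∀ i, a i ∈ A) : IsStack A w (fun x i => a i (x i))
  | comp {F G : (Fin w → ℝ) → (Fin w → ℝ)} (hF : IsStack A w F) (hG : IsStack A w G) :
      IsStack A w (F ∘ G)

lemma Computes.stack {A : Set (ℝ → ℝ)} {m w : ℕ} {S : Set ℕ} (hw : 0 < w) (hS : w ∈ S)
    {F : (Fin w → ℝ) → (Fin w → ℝ)} (hF : IsStack A w F) {f : (Fin m → ℝ) → (Fin w → ℝ)}
    (hf : Computes A S f) : Computes A S (fun x => F (f x)) := by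
  induction hF generalizing f with
  | affine W b => exact hf.affine W b
  | act a ha => simpa only [Set.insert_eq_of_mem hS] using hf.act hw ha
  | comp _ _ ihF ihG => exact ihF (ihG hf)

lemma IsStack.id {A : Set (ℝ → ℝ)} {w : ℕ} : IsStack A w (fun x => x) := by
  simpa using IsStack.affine (A := A) (w := w) 1 0

lemma IsStack.continuous {A : Set (ℝ → ℝ)} (hA : ∀ a ∈ A, Continuous a) {w : ℕ}
    {F : (Fin w → ℝ) → (Fin w → ℝ)} (hF : IsStack A w F) : Continuous F := by
  induction hF with
  | affine W b => exact (continuous_const.matrix_mulVec continuous_id).add continuous_const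
  | act a ha => exact continuous_pi fun i => (hA _ (ha i)).comp (continuous_apply i)
  | comp _ _ ihF ihG => exact ihF.comp ihG

/-! ### Leaky rectified linear units -/

lemma leakyReLU_of_nonneg {a x : ℝ} (hx : 0 ≤ x) : leakyReLU a x = x := by
  simp [leakyReLU, not_lt.2 hx]

lemma leakyReLU_of_nonpos {a x : ℝ} (hx : x ≤ 0) : leakyReLU a x = a * x := by
  rcases hx.lt_or_eq with h | rfl
  · simp [leakyReLU, h]
  · simp [leakyReLU]

lemma leakyReLU_one (x : ℝ) : leakyReLU 1 x = x := by
  simp [leakyReLU]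

lemma leakyReLU_leakyReLU (a : ℝ) {b : ℝ} (hb : 0 < b) (x : ℝ) :
    leakyReLU a (leakyReLU b x) = leakyReLU (a * b) x := by
  rcases le_total 0 x with h | h
  · simp [leakyReLU_of_nonneg h]
  · rw [leakyReLU_of_nonpos (a := b) h, leakyReLU_of_nonpos h,
      leakyReLU_of_nonpos (mul_nonpos_of_nonneg_of_nonpos hb.le h), mul_assoc]

/-- Reflection at the origin turns slope `a` into slope `a⁻¹`. -/
lemma leakyReLU_eq_neg_mul {a : ℝ} (ha : 0 < a) (x : ℝ) :
    leakyReLU a x = -a * leakyReLU a⁻¹ (-x) := by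
  rcases le_total 0 x with h | h
  · rw [leakyReLU_of_nonneg h, leakyReLU_of_nonpos (by linarith)]; field_simp
  · rw [leakyReLU_of_nonpos h, leakyReLU_of_nonneg (by linarith)]; ring

lemma strictMono_leakyReLU {a : ℝ} (ha : 0 < a) : StrictMono (leakyReLU a) := by
  intro x y hxy
  simp only [leakyReLU]
  split_ifs <;> nlinarith

lemma abs_leakyReLU_sub_le {a : ℝ} (ha : 0 < a) (ha1 : a ≤ 1) (x y : ℝ) :
    |leakyReLU a x - leakyReLU a y| ≤ |x - y| := by
  wlog h : y ≤ x generalizing x y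
  · rw [abs_sub_comm, abs_sub_comm x]; exact this y x (not_le.1 h).le
  rw [abs_of_nonneg (sub_nonneg.2 ((strictMono_leakyReLU ha).monotone h)),
    abs_of_nonneg (sub_nonneg.2 h)]
  simp only [leakyReLU]
  split_ifs <;> nlinarith

lemma continuous_leakyReLU (a : ℝ) : Continuous (leakyReLU a) := by
  refine Continuous.if_le (by fun_prop) (by fun_prop) continuous_const continuous_id ?_ |>.congr
    (f := fun x => if 0 ≤ x then x else a * x) fun x => ?_
  · rintro x rfl; simp
  · by_cases h : x < 0
    · simp [leakyReLU, h, not_le.2 h]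
    · simp [leakyReLU, h, not_lt.1 h]

lemma leakyReLU_mem {a : ℝ} (h0 : 0 < a) (h1 : a < 1) : leakyReLU a ∈ trueLeakyReLUs :=
  ⟨a, h0, h1, rfl⟩

lemma continuous_of_mem_trueLeakyReLUs {σ : ℝ → ℝ} (h : σ ∈ trueLeakyReLUs) : Continuous σ := by
  obtain ⟨a, -, -, rfl⟩ := h
  exact continuous_leakyReLU a

lemma strictMono_of_mem_trueLeakyReLUs {σ : ℝ → ℝ} (h : σ ∈ trueLeakyReLUs) : StrictMono σ := by
  obtain ⟨a, ha, -, rfl⟩ := h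
  exact strictMono_leakyReLU ha

/-- A leaky ReLU in the last layer is undone by one more layer of the same dimension. -/
lemma Computes.of_leakyReLU {m n : ℕ} {S : Set ℕ} {f : (Fin m → ℝ) → (Fin n → ℝ)} (hn : 0 < n)
    (hS : n ∈ S) (hf : Computes trueLeakyReLUs S (fun x i => leakyReLU (1 / 2) (f x i))) :
    Computes trueLeakyReLUs S f := by
  have h := ((hf.affine (-1 : Matrix (Fin n) (Fin n) ℝ) 0).act hn
    (a := fun _ => leakyReLU (1 / 2)) fun _ => leakyReLU_mem (by norm_num) (by norm_num)).affine
    ((-2 : ℝ) • (1 : Matrix (Fin n) (Fin n) ℝ)) 0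
  rw [Set.insert_eq_of_mem hS] at h
  convert h using 1
  funext x i
  have := leakyReLU_eq_neg_mul (a := 2) (by norm_num) (leakyReLU (1 / 2) (f x i))
  rw [leakyReLU_leakyReLU _ (by norm_num), show (2 : ℝ) * (1 / 2) = 1 by norm_num,
    leakyReLU_one] at this
  simpa [Matrix.neg_mulVec, Matrix.smul_mulVec] using this

/-- Further layers of dimension `n` can be inserted without changing the function. -/
lemma Computes.insert_dim {m n : ℕ} {S : Set ℕ} {f : (Fin m → ℝ) → (Fin n → ℝ)}
    (hf : Computes trueLeakyReLUs S f) (hn : 0 < n) :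
    Computes trueLeakyReLUs (insert n S) f :=
  .of_leakyReLU hn (Set.mem_insert n S)
    (hf.act hn fun _ => leakyReLU_mem (by norm_num) (by norm_num))

lemma Computes.of_affine {m n : ℕ} (hn : 0 < n) (W : Matrix (Fin n) (Fin m) ℝ)
    (b : Fin n → ℝ) : Computes trueLeakyReLUs {n} (fun x : Fin m → ℝ => W *ᵥ x + b) :=
  .of_leakyReLU hn (Set.mem_singleton n)
    (.single hn W b fun _ => leakyReLU_mem (by norm_num) (by norm_num))

/-! ### Maps acting on one coordinate -/

/-- Applying `h` to the coordinate `i` and fixing all others is a stack of leaky ReLU layers. -/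
def IsCoord (w : ℕ) (i : Fin w) (h : ℝ → ℝ) : Prop :=
  IsStack trueLeakyReLUs w (fun x => Function.update x i (h (x i)))

namespace IsCoord

lemma comp {w : ℕ} {i : Fin w} {g h : ℝ → ℝ} (hg : IsCoord w i g) (hh : IsCoord w i h) :
    IsCoord w i (fun x => g (h x)) := by
  have := IsStack.comp hg hh
  simpa [IsCoord, Function.comp_def] using this

lemma affine {w : ℕ} (i : Fin w) (c b : ℝ) : IsCoord w i (fun x => c * x + b) := by
  have := IsStack.affine (A := trueLeakyReLUs) (Matrix.diagonal (Function.update 1 i c))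
    (Pi.single i b)
  unfold IsCoord
  convert this using 1
  funext x j
  rw [Pi.add_apply, Matrix.mulVec_diagonal]
  by_cases h : j = i
  · subst h; simp
  · simp [h]

/-- With `β² = a`, the other coordinates are restored by slope `β⁻¹` while the coordinate `i`
receives slope `β` twice. -/
lemma leaky_of_lt_one {w : ℕ} (i : Fin w) {a : ℝ} (h0 : 0 < a) (h1 : a < 1) :
    IsCoord w i (leakyReLU a) := by
  set β := Real.sqrt a with hβ
  have hβ0 : 0 < β := Real.sqrt_pos.2 h0
  have hβ1 : β < 1 := by rw [hβ, Real.sqrt_lt' one_pos]; simpa using h1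
  have hββ : β * β = a := Real.mul_self_sqrt h0.le
  have hact := IsStack.act (A := trueLeakyReLUs) (fun _ : Fin w => leakyReLU β)
    (fun _ => leakyReLU_mem hβ0 hβ1)
  have hneg := IsStack.affine (A := trueLeakyReLUs)
    (Matrix.diagonal (Function.update (fun _ => -1) i 1)) 0
  have hscale := IsStack.affine (A := trueLeakyReLUs)
    (Matrix.diagonal (Function.update (fun _ => -β⁻¹) i 1)) 0
  have := ((hscale.comp hact).comp hneg).comp hact
  unfold IsCoord
  convert this using 1
  funext x j
  simp only [Function.comp_apply, add_zero, Matrix.mulVec_diagonal]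
  by_cases h : j = i
  · subst h; simp [leakyReLU_leakyReLU _ hβ0, hββ]
  · have := leakyReLU_eq_neg_mul (inv_pos.2 hβ0) (leakyReLU β (x j))
    rw [leakyReLU_leakyReLU _ hβ0, inv_mul_cancel₀ hβ0.ne', leakyReLU_one, inv_inv] at this
    simpa [h] using this

lemma leaky {w : ℕ} (i : Fin w) {a : ℝ} (ha : 0 < a) : IsCoord w i (leakyReLU a) := by
  rcases lt_trichotomy a 1 with h | rfl | h
  · exact leaky_of_lt_one i ha h
  · rw [funext leakyReLU_one]; simpa using affine i 1 0
  · have := ((affine i (-a) 0).comp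
      (leaky_of_lt_one i (inv_pos.2 ha) (inv_lt_one_of_one_lt₀ h))).comp (affine i (-1) 0)
    convert this using 1
    funext x
    rw [leakyReLU_eq_neg_mul ha]; simp

/-- Increasing data can be interpolated: the breakpoint at the last value already attained leaves
the earlier values unchanged, and its slope is chosen to reach the next one. -/
lemma exists_interpolation {w : ℕ} (i : Fin w) {x y : ℕ → ℝ} (hx : StrictMono x)
    (hy : StrictMono y) (n : ℕ) :
    ∃ h : ℝ → ℝ, IsCoord w i h ∧ StrictMono h ∧ ∀ k ≤ n, h (x k) = y k := by
  induction n with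
  | zero =>
    refine ⟨fun t => 1 * t + (y 0 - x 0), affine i _ _, fun s t hst => by simpa using hst, ?_⟩
    intro k hk
    rw [Nat.le_zero.1 hk]; ring
  | succ n ih =>
    obtain ⟨h, hc, hm, hk⟩ := ih
    have hpos : 0 < h (x (n + 1)) - y n := by
      rw [← hk n le_rfl]; exact sub_pos.2 (hm (hx n.lt_succ_self))
    have hpos' : 0 < y (n + 1) - y n := sub_pos.2 (hy n.lt_succ_self)
    set s := (y (n + 1) - y n) / (h (x (n + 1)) - y n) with hs
    have hs0 : 0 < s := div_pos hpos' hpos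
    refine ⟨fun t => s * leakyReLU s⁻¹ (1 * h t + -y n) + y n,
      (affine i s (y n)).comp ((leaky i (inv_pos.2 hs0)).comp ((affine i 1 (-y n)).comp hc)), ?_,
      fun k hkn => ?_⟩
    · intro a b hab
      have := strictMono_leakyReLU (inv_pos.2 hs0)
        (show 1 * h a + -y n < 1 * h b + -y n by simpa using hm hab)
      simpa using mul_lt_mul_of_pos_left this hs0
    · rcases Nat.le_succ_iff.1 hkn with h' | rfl
      · simp only [hk k h']
        rw [leakyReLU_of_nonpos (by linarith [hy.monotone h'])]
        field_simp; ring
      · simp only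
        rw [leakyReLU_of_nonneg (by linarith), hs]
        field_simp; ring

end IsCoord

/-! ### Shears -/

/-- Adding `g` of the coordinate `i` to the coordinate `j` is a stack of leaky ReLU layers. -/
def IsShear (w : ℕ) (i j : Fin w) (g : ℝ → ℝ) : Prop :=
  IsStack trueLeakyReLUs w (fun x => Function.update x j (x j + g (x i)))

namespace IsShear

lemma add {w : ℕ} {i j : Fin w} (hij : i ≠ j) {g h : ℝ → ℝ} (hg : IsShear w i j g)
    (hh : IsShear w i j h) : IsShear w i j (fun x => g x + h x) := by
  have := IsStack.comp hg hh
  unfold IsShear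
  convert this using 1
  funext x
  simp [Function.update_of_ne hij, add_assoc, add_comm (g _)]

lemma linear {w : ℕ} {i j : Fin w} (c : ℝ) : IsShear w i j (fun x => c * x) := by
  have := IsStack.affine (A := trueLeakyReLUs) (Matrix.transvection j i c) 0
  unfold IsShear
  convert this using 1
  funext x k
  by_cases h : k = j
  · subst h; simp [Matrix.transvection, Matrix.add_mulVec, Matrix.single_mulVec]
  · simp [Matrix.transvection, Matrix.add_mulVec, Matrix.single_mulVec, h]

/-- Conjugating a linear shear by a map of the coordinate `i`. -/
lemma conj {w : ℕ} {i j : Fin w} (hij : i ≠ j) {g h h' : ℝ → ℝ} (hg : IsShear w i j g)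
    (hh : IsCoord w i h) (hh' : IsCoord w i h') (hinv : ∀ x, h' (h x) = x) :
    IsShear w i j (fun x => g (h x)) := by
  have := IsStack.comp hh' (IsStack.comp hg hh)
  unfold IsShear
  convert this using 1
  funext x k
  simp only [Function.comp_apply, Function.update_self, Function.update_of_ne hij,
    Function.update_of_ne hij.symm, hinv]
  by_cases h1 : k = i
  · subst h1; simp [hij]
  · by_cases h2 : k = j
    · subst h2; simp [h1]
    · simp [h1, h2]

lemma const {w : ℕ} {i j : Fin w} (b : ℝ) : IsShear w i j (fun _ => b) := by
  simpa [IsCoord, IsShear] using IsCoord.affine j 1 b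

lemma relu {w : ℕ} {i j : Fin w} (hij : i ≠ j) (c b : ℝ) :
    IsShear w i j (fun x => c * max (x - b) 0) := by
  have h1 : IsCoord w i (fun x => leakyReLU (1 / 2) (1 * x + -b)) :=
    (IsCoord.leaky i (by norm_num)).comp (IsCoord.affine i 1 (-b))
  have h2 : IsCoord w i (fun x => 1 * leakyReLU 2 x + b) :=
    (IsCoord.affine i 1 b).comp (IsCoord.leaky i (by norm_num))
  have h3 := (conj hij (linear (2 * c)) h1 h2 fun x => by
    rw [leakyReLU_leakyReLU _ (by norm_num), show (2 : ℝ) * (1 / 2) = 1 by norm_num,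
      leakyReLU_one]; ring).add hij ((linear (-c)).add hij (const (c * b)))
  convert h3 using 1
  funext x
  rcases le_total 0 (x - b) with h | h
  · rw [max_eq_left h, leakyReLU_of_nonneg (by linarith)]; ring
  · rw [max_eq_right h, leakyReLU_of_nonpos (by linarith)]; ring

lemma exists_interpolation_finset {w : ℕ} {i j : Fin w} (hij : i ≠ j) (s : Finset ℝ)
    (u : ℝ → ℝ) : ∃ g : ℝ → ℝ, IsShear w i j g ∧ ∀ x ∈ s, g x = u x := by
  induction s using Finset.induction_on_max with
  | empty => exact ⟨_, const 0, by simp⟩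
  | insert a s hs ih =>
    obtain ⟨g, hg, hgu⟩ := ih
    -- a breakpoint between `s` and `a` changes the value at `a` only
    obtain ⟨b, hb, hba⟩ : ∃ b, (∀ x ∈ s, x ≤ b) ∧ b < a := by
      rcases s.eq_empty_or_nonempty with rfl | hne
      · exact ⟨a - 1, by simp, by linarith⟩
      · exact ⟨s.max' hne, fun x hx => s.le_max' x hx, hs _ (s.max'_mem hne)⟩
    refine ⟨_, hg.add hij (relu hij ((u a - g a) / (a - b)) b), fun x hx => ?_⟩
    rcases Finset.mem_insert.1 hx with rfl | hx
    · rw [max_eq_left (by linarith)]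
      have : x - b ≠ 0 := by linarith
      field_simp; ring
    · rw [max_eq_right (by linarith [hb x hx]), hgu x hx]; ring

/-- Shears interpolate arbitrary values at finitely many distinct points. -/
lemma exists_interpolation {w : ℕ} {i j : Fin w} (hij : i ≠ j) {ι : Type*} [Fintype ι]
    {t : ι → ℝ} (ht : Function.Injective t) (u : ι → ℝ) :
    ∃ g : ℝ → ℝ, IsShear w i j g ∧ ∀ k, g (t k) = u k := by
  classical
  obtain ⟨g, hg, h⟩ := exists_interpolation_finset hij (Finset.univ.image t)
    (Function.extend t u 0)
  exact ⟨g, hg, fun k => by rw [h _ (by simp), ht.extend_apply]⟩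

end IsShear

/-! ### Decoding finitely many scalars -/

lemma exists_injective_abs_sub_lt {ι : Type*} [Fintype ι] (u : ι → ℝ) {ε : ℝ} (hε : 0 < ε) :
    ∃ v : ι → ℝ, Function.Injective v ∧ ∀ k, |v k - u k| < ε := by
  classical
  suffices H : ∀ s : Finset ι, ∃ v : ι → ℝ, Set.InjOn v s ∧ ∀ k, |v k - u k| < ε by
    obtain ⟨v, hv, h⟩ := H Finset.univ
    exact ⟨v, by simpa using hv, h⟩
  intro s
  induction s using Finset.induction_on with
  | empty => exact ⟨u, by simp, fun _ => by simpa using hε⟩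
  | insert a s ha ih =>
    obtain ⟨v, hv, h⟩ := ih
    obtain ⟨z, hz, hzs⟩ := ((Set.Ioo_infinite (show u a - ε < u a + ε by linarith)).sdiff
      (s.image v).finite_toSet).nonempty
    refine ⟨Function.update v a z, ?_, fun k => ?_⟩
    · have hne (k) (hk : k ∈ s) : k ≠ a := fun h => ha (h ▸ hk)
      rw [Finset.coe_insert, Set.injOn_insert (by simpa using ha)]
      refine ⟨fun x hx y hy hxy => hv hx hy ?_, ?_⟩
      · simpa [hne x hx, hne y hy] using hxy
      · rintro ⟨k, hk, hkz⟩
        simp only [Function.update_self, Function.update_of_ne (hne k hk)] at hkz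
        exact hzs (by simpa using ⟨k, hk, hkz⟩)
    · by_cases hk : k = a
      · subst hk
        rw [Function.update_self, abs_lt]
        constructor <;> linarith [hz.1, hz.2]
      · rw [Function.update_of_ne hk]; exact h k

/-- Keeping the scalar in the coordinate `i₀`, shears write the values into all other coordinates.
The coordinate `i₁` then separates the points, so a last shear out of it can overwrite `i₀`. -/
lemma exists_decoder_of_injective {w : ℕ} {i₀ i₁ : Fin w} (h01 : i₀ ≠ i₁) {ι : Type*} [Fintype ι]
    {t : ι → ℝ} (ht : Function.Injective t) (v : ι → Fin w → ℝ)
    (hv : Function.Injective fun k => v k i₁) :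
    ∃ F, IsStack trueLeakyReLUs w F ∧ ∀ k, F (Pi.single i₀ (t k)) = v k := by
  have key : ∀ J : Finset (Fin w), i₀ ∉ J → ∃ F, IsStack trueLeakyReLUs w F ∧
      ∀ k i, F (Pi.single i₀ (t k)) i = if i = i₀ then t k else if i ∈ J then v k i else 0 := by
    intro J
    induction J using Finset.induction_on with
    | empty => exact fun _ => ⟨_, IsStack.id, fun k i => by simp [Pi.single_apply]⟩
    | insert j J hj ih =>
      intro hi
      rw [Finset.mem_insert, not_or] at hi
      obtain ⟨F, hF, h⟩ := ih hi.2
      obtain ⟨g, hg, hgt⟩ := IsShear.exists_interpolation hi.1 ht fun k => v k j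
      refine ⟨_, IsStack.comp hg hF, fun k i => ?_⟩
      by_cases hij : i = j
      · subst hij
        simp [h, hj, Ne.symm hi.1, hgt]
      · simp [h, hij]
  obtain ⟨F, hF, h⟩ := key (Finset.univ.erase i₀) (by simp)
  obtain ⟨g, hg, hgt⟩ := IsShear.exists_interpolation h01.symm hv fun k => v k i₀ - t k
  refine ⟨_, IsStack.comp hg hF, fun k => funext fun i => ?_⟩
  by_cases hi : i = i₀
  · subst hi
    simp [h, h01.symm, hgt]
  · simp [h, hi]

lemma exists_decoder {w : ℕ} {i₀ i₁ : Fin w} (h01 : i₀ ≠ i₁) {ι : Type*} [Fintype ι]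
    {t : ι → ℝ} (ht : Function.Injective t) (v : ι → Fin w → ℝ) {ε : ℝ} (hε : 0 < ε) :
    ∃ F, IsStack trueLeakyReLUs w F ∧ ∀ k i, |F (Pi.single i₀ (t k)) i - v k i| < ε := by
  obtain ⟨u, hu, huv⟩ := exists_injective_abs_sub_lt (fun k => v k i₁) hε
  obtain ⟨F, hF, h⟩ := exists_decoder_of_injective h01 ht
    (fun k => Function.update (v k) i₁ (u k)) (by simpa using hu)
  refine ⟨F, hF, fun k i => ?_⟩
  rw [h]
  by_cases hi : i = i₁
  · subst hi; simpa using huv k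
  · simpa [hi] using hε

/-! ### Encoding a grid by a scalar -/

/-- Increasing maps of one coordinate converge to the floor function away from the integers: on
the cell `[k, k + 1]`, shrunk by `δ` at both ends, the values are between `k` and `k + δ`. -/
lemma IsCoord.exists_tendsto_floor {w : ℕ} (i : Fin w) (N : ℕ) :
    ∃ h : ℕ → ℝ → ℝ, (∀ n, IsCoord w i (h n)) ∧
      (∀ n, ∀ x ∈ Set.Icc (1 : ℝ) N, h n x ∈ Set.Icc (0 : ℝ) N) ∧
      ∀ x ∈ Set.Icc (1 : ℝ) N, (∀ k : ℕ, x ≠ k) →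
        Filter.Tendsto (fun n => h n x) Filter.atTop (nhds (⌊x⌋₊ : ℝ)) := by
  have hδ (n : ℕ) : 0 < 1 / ((n : ℝ) + 3) ∧ 1 / ((n : ℝ) + 3) < 1 / 2 := by
    have : (0 : ℝ) ≤ n := n.cast_nonneg
    exact ⟨by positivity, one_div_lt_one_div_of_lt (by norm_num) (by linarith)⟩
  have hlim : Filter.Tendsto (fun n : ℕ => 1 / ((n : ℝ) + 3)) Filter.atTop (nhds 0) := by
    have := (tendsto_const_div_atTop_nhds_zero_nat (1 : ℝ)).comp (Filter.tendsto_add_atTop_nat 3)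
    simpa [Function.comp_def] using this
  have H (n : ℕ) : ∃ h : ℝ → ℝ, IsCoord w i h ∧ StrictMono h ∧ ∀ k ≤ N,
      h (k + 1 / ((n : ℝ) + 3)) = k ∧
      h (k + 1 - 1 / ((n : ℝ) + 3)) = k + 1 / ((n : ℝ) + 3) := by
    obtain ⟨h0, h1⟩ := hδ n
    set δ := 1 / ((n : ℝ) + 3)
    obtain ⟨h, hc, hm, hk⟩ := IsCoord.exists_interpolation i
      (x := fun m => if Even m then ((m / 2 : ℕ) : ℝ) + δ else ((m / 2 : ℕ) : ℝ) + 1 - δ)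
      (y := fun m => if Even m then ((m / 2 : ℕ) : ℝ) else ((m / 2 : ℕ) : ℝ) + δ)
      (strictMono_nat_of_lt_succ fun m => by
        rcases Nat.even_or_odd' m with ⟨l, rfl | rfl⟩
        · simp [show (2 * l + 1) / 2 = l by omega]; linarith
        · simp [Nat.even_add_one, show (2 * l + 1) / 2 = l by omega,
            show (2 * l + 1 + 1) / 2 = l + 1 by omega]; linarith)
      (strictMono_nat_of_lt_succ fun m => by
        rcases Nat.even_or_odd' m with ⟨l, rfl | rfl⟩
        · simp [show (2 * l + 1) / 2 = l by omega]; linarith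
        · simp [Nat.even_add_one, show (2 * l + 1) / 2 = l by omega,
            show (2 * l + 1 + 1) / 2 = l + 1 by omega]; linarith) (2 * N + 1)
    refine ⟨h, hc, hm, fun k hkN => ⟨?_, ?_⟩⟩
    · simpa using hk (2 * k) (by omega)
    · simpa [Nat.even_add_one, show (2 * k + 1) / 2 = k by omega] using hk (2 * k + 1) (by omega)
  choose h hc hm hk using H
  refine ⟨h, hc, fun n x hx => ⟨?_, ?_⟩, fun x hx hxk => ?_⟩
  · rw [← (Nat.cast_zero (R := ℝ)), ← (hk n 0 (Nat.zero_le _)).1]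
    exact (hm n).monotone (by simp only [Nat.cast_zero]; linarith [hx.1, (hδ n).2])
  · rw [← (hk n N le_rfl).1]
    exact (hm n).monotone (by linarith [hx.2, (hδ n).1])
  · have hx0 : 0 ≤ x := zero_le_one.trans hx.1
    have hfl : (⌊x⌋₊ : ℝ) < x := (Nat.floor_le hx0).lt_of_ne (hxk _).symm
    have hfl' : x < ⌊x⌋₊ + 1 := Nat.lt_floor_add_one x
    have hN : ⌊x⌋₊ ≤ N := Nat.floor_le_of_le hx.2
    have hup : Filter.Tendsto (fun n : ℕ => (⌊x⌋₊ : ℝ) + 1 / ((n : ℝ) + 3)) Filter.atTop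
        (nhds (⌊x⌋₊ : ℝ)) := by simpa using hlim.const_add (⌊x⌋₊ : ℝ)
    refine tendsto_of_tendsto_of_tendsto_of_le_of_le' tendsto_const_nhds hup ?_ ?_
    · filter_upwards [hlim.eventually_lt_const (sub_pos.2 hfl)] with n hn
      conv_lhs => rw [← (hk n _ hN).1]
      exact (hm n).monotone (by linarith)
    · filter_upwards [hlim.eventually_lt_const (sub_pos.2 hfl')] with n hn
      rw [← (hk n _ hN).2]
      exact (hm n).monotone (by linarith)

lemma IsStack.of_isCoord {w : ℕ} {h : Fin w → ℝ → ℝ} (hh : ∀ i, IsCoord w i (h i)) :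
    IsStack trueLeakyReLUs w (fun x i => h i (x i)) := by
  suffices H : ∀ J : Finset (Fin w),
      IsStack trueLeakyReLUs w (fun x i => if i ∈ J then h i (x i) else x i) by
    simpa using H Finset.univ
  intro J
  induction J using Finset.induction_on with
  | empty => simpa using IsStack.id
  | insert j J hj ih =>
    convert IsStack.comp (hh j) ih using 1
    funext x i
    by_cases hi : i = j
    · subst hi; simp [hj]
    · simp [hi]

/-- Base `N + 1` expansion with real digits. -/
def baseExpansion (d N : ℕ) (y : Fin d → ℝ) : ℝ := ∑ j : Fin d, y j * ((N : ℝ) + 1) ^ (j : ℕ)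

lemma baseExpansion_injective (d N : ℕ) :
    Function.Injective fun k : Fin d → Fin (N + 1) => baseExpansion d N fun j => (k j : ℝ) := by
  intro k l hkl
  apply finFunctionFinEquiv.injective
  apply Fin.ext
  rw [finFunctionFinEquiv_apply, finFunctionFinEquiv_apply]
  simp only [baseExpansion] at hkl
  exact_mod_cast hkl

lemma continuous_baseExpansion (d N : ℕ) : Continuous (baseExpansion d N) := by
  unfold baseExpansion; fun_prop

/-! ### Approximation of uniformly continuous functions -/

/-- Affine normalization, staircases, base expansion, decoder and projection compose to a network
with one hidden layer of dimension `1` among hidden layers of dimension `w`. -/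
lemma computes_encoder_decoder {m n w N : ℕ} (hw : 0 < w) (hm : m ≤ w) (hn : n ≤ w) (i₀ : Fin w)
    (c b : ℝ) {h : Fin w → ℝ → ℝ} (hh : ∀ i, IsCoord w i (h i))
    {F : (Fin w → ℝ) → (Fin w → ℝ)} (hF : IsStack trueLeakyReLUs w F) :
    Computes trueLeakyReLUs {1, w} (fun (x : Fin m → ℝ) (i : Fin n) =>
      F (Pi.single i₀ (baseExpansion m N fun j => h (Fin.castLE hm j) (c * x j + b)))
        (Fin.castLE hn i)) := by
  have hrow {l : ℕ} (hl : l ≤ w) (y : Fin w → ℝ) (i : Fin l) :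
      ((1 : Matrix (Fin w) (Fin w) ℝ).submatrix (Fin.castLE hl) id *ᵥ y) i
        = y (Fin.castLE hl i) := by
    simp [Matrix.mulVec, dotProduct, Matrix.one_apply]
  have hcol (x : Fin m → ℝ) (j : Fin m) :
      ((1 : Matrix (Fin w) (Fin w) ℝ).submatrix id (Fin.castLE hm) *ᵥ x) (Fin.castLE hm j)
        = x j := by
    simp [Matrix.mulVec, dotProduct, Matrix.one_apply]
  have hstairs : Computes trueLeakyReLUs {w}
      (fun (x : Fin m → ℝ) j => h (Fin.castLE hm j) (c * x j + b)) := by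
    convert ((Computes.of_affine hw
      (c • (1 : Matrix (Fin w) (Fin w) ℝ).submatrix id (Fin.castLE hm)) (fun _ => b)).stack hw
      (Set.mem_singleton w) (IsStack.of_isCoord hh)).affine
      ((1 : Matrix (Fin w) (Fin w) ℝ).submatrix (Fin.castLE hm) id) 0 using 1
    funext x j
    rw [add_zero, hrow, Pi.add_apply, Matrix.smul_mulVec, Pi.smul_apply, hcol, smul_eq_mul]
  have hcode := (hstairs.affine
    (Matrix.of fun (_ : Fin 1) (j : Fin m) => ((N : ℝ) + 1) ^ (j : ℕ)) 0).insert_dim one_pos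
  convert ((hcode.affine (Matrix.of fun i (_ : Fin 1) => if i = i₀ then (1 : ℝ) else 0)
    0).stack hw (by simp) hF).affine
    ((1 : Matrix (Fin w) (Fin w) ℝ).submatrix (Fin.castLE hn) id) 0 using 1
  funext x i
  rw [add_zero, hrow]
  congr 2
  funext k
  simp [-Matrix.mulVec_mulVec, Matrix.mulVec, dotProduct, Pi.single_apply, baseExpansion, mul_comm]

/-- Uniformly bounded networks converge almost everywhere on a compact set to a function, constant
on the cells of a fine grid, that is uniformly close to `g`. -/
lemma exists_computes_tendsto {m n w : ℕ} (hw : 2 ≤ w) (hm : m ≤ w) (hn : n ≤ w)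
    {g : (Fin m → ℝ) → (Fin n → ℝ)} (hg : UniformContinuous g) {K : Set (Fin m → ℝ)}
    (hK : IsCompact K) {ε : ℝ} (hε : 0 < ε) :
    ∃ (Φ : ℕ → (Fin m → ℝ) → (Fin n → ℝ)) (s : (Fin m → ℝ) → (Fin n → ℝ)) (C : ℝ),
      (∀ l, Computes trueLeakyReLUs {1, w} (Φ l)) ∧ (∀ l, ∀ x ∈ K, ‖Φ l x‖ ≤ C) ∧
      (∀ᵐ x, x ∈ K → Filter.Tendsto (fun l => Φ l x) Filter.atTop (nhds (s x))) ∧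
      ∀ x ∈ K, ‖s x - g x‖ ≤ ε := by
  obtain ⟨δ, hδ, hgδ⟩ := Metric.uniformContinuous_iff.1 hg (ε / 2) (half_pos hε)
  obtain ⟨R, hR, hKR⟩ := hK.isBounded.exists_pos_norm_le
  obtain ⟨c, hc⟩ := exists_gt (1 / δ)
  have hc0 : 0 < c := (one_div_pos.2 hδ).trans hc
  -- the affine map `t ↦ c t + b` sends the coordinates of points of `K` into `[1, N]`
  set b := 1 + c * R with hb
  set N := ⌈1 + 2 * c * R⌉₊ with hN
  have hrange (x) (hx : x ∈ K) (j : Fin m) : c * x j + b ∈ Set.Icc (1 : ℝ) N := by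
    have h1 := abs_le.1 ((norm_le_pi_norm x j).trans (hKR x hx))
    have h2 := Nat.le_ceil (1 + 2 * c * R)
    constructor
    · nlinarith
    · nlinarith
  set i₀ : Fin w := ⟨0, by omega⟩
  set i₁ : Fin w := ⟨1, by omega⟩
  have h01 : i₀ ≠ i₁ := by simp [i₀, i₁]
  obtain ⟨F, hF, hFv⟩ := exists_decoder h01 (baseExpansion_injective m N)
    (fun k i => if hi : (i : ℕ) < n then g (fun j => ((k j : ℝ) - b) / c) ⟨i, hi⟩ else 0)
    (half_pos hε)
  choose h hhc hhr hht using fun i : Fin w => IsCoord.exists_tendsto_floor i N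
  set D : (Fin m → ℝ) → (Fin n → ℝ) := fun y i =>
    F (Pi.single i₀ (baseExpansion m N y)) (Fin.castLE hn i) with hD
  have hDc : Continuous D := by
    refine continuous_pi fun i => (continuous_apply _).comp
      ((hF.continuous fun _ => continuous_of_mem_trueLeakyReLUs).comp ?_)
    exact (continuous_single i₀).comp (continuous_baseExpansion m N)
  obtain ⟨C, hC⟩ := (isCompact_Icc (a := (0 : Fin m → ℝ))
    (b := fun _ => (N : ℝ))).exists_bound_of_continuousOn hDc.continuousOn
  refine ⟨fun l x => D fun j => h (Fin.castLE hm j) l (c * x j + b),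
    fun x => D fun j => (⌊c * x j + b⌋₊ : ℝ), C, fun l => ?_, fun l x hx => ?_, ?_, fun x hx => ?_⟩
  · exact computes_encoder_decoder (by omega) hm hn i₀ c b (fun i => hhc i l) hF
  · exact hC _ ⟨fun j => (hhr _ l _ (hrange x hx j)).1, fun j => (hhr _ l _ (hrange x hx j)).2⟩
  · have hae : ∀ᵐ x : Fin m → ℝ, ∀ (j : Fin m) (k : ℕ), x j ≠ (k - b) / c := by
      simp only [ae_all_iff]
      intro j k
      exact compl_mem_ae_iff.2 (Measure.pi_hyperplane (fun _ => volume) j _)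
    filter_upwards [hae] with x hx hxK
    refine (hDc.tendsto _).comp (tendsto_pi_nhds.2 fun j => ?_)
    refine hht _ _ (hrange x hxK j) fun k hk => hx j k ?_
    rw [← hk]; field_simp; ring
  · have hfl (j) : ⌊c * x j + b⌋₊ < N + 1 :=
      Nat.lt_succ_of_le (Nat.floor_le_of_le (hrange x hx j).2)
    have hgx := hgδ (a := fun j => ((⌊c * x j + b⌋₊ : ℝ) - b) / c) (b := x) (by
      rw [dist_pi_lt_iff hδ]
      intro j
      have h1 := Nat.floor_le (zero_le_one.trans (hrange x hx j).1)
      have h2 := Nat.lt_floor_add_one (c * x j + b)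
      have h3 : ((⌊c * x j + b⌋₊ : ℝ) - b) / c - x j = -((c * x j + b - ⌊c * x j + b⌋₊) / c) := by
        field_simp; ring
      have h4 : 1 < c * δ := by rwa [div_lt_iff₀ hδ] at hc
      rw [Real.dist_eq, h3, abs_neg, abs_of_nonneg (div_nonneg (by linarith) hc0.le),
        div_lt_iff₀ hc0]
      linarith)
    refine (pi_norm_le_iff_of_nonneg hε.le).2 fun i => ?_
    have h5 := hFv (fun j => ⟨⌊c * x j + b⌋₊, hfl j⟩) (Fin.castLE hn i)
    have h6 := (dist_le_pi_dist _ _ i).trans hgx.le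
    simp only [Fin.val_castLE, i.2, dif_pos] at h5
    rw [Real.dist_eq] at h6
    rw [Pi.sub_apply, Real.norm_eq_abs]
    refine (abs_sub_le _ _ _).trans ((add_le_add h5.le h6).trans (by linarith))

/-! ### Approximation in `L^p` -/

lemma FNN.continuous_eval {A : Set (ℝ → ℝ)} (hA : ∀ a ∈ A, Continuous a) {m n : ℕ}
    (φ : FNN A m n) : Continuous φ.eval := by
  have hL {k l : ℕ} (L : Layer A k l) : Continuous L.eval :=
    continuous_pi fun i => (hA _ (L.act_mem i)).comp ((continuous_apply i).comp
      ((continuous_const.matrix_mulVec continuous_id).add continuous_const))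
  induction φ with
  | single L => exact hL L
  | snoc φ _ L ih => exact (hL L).comp ih

lemma Computes.continuous {m n : ℕ} {S : Set ℕ} {f : (Fin m → ℝ) → (Fin n → ℝ)}
    (hf : Computes trueLeakyReLUs S f) : Continuous f := by
  obtain ⟨j, φ, V, c, -, -, h⟩ := hf
  rw [funext h]
  exact (continuous_const.matrix_mulVec
    (φ.continuous_eval fun _ => continuous_of_mem_trueLeakyReLUs)).add continuous_const

/-- Bounded convergence in `L^p`. -/
lemma tendsto_eLpNorm_of_norm_le {X E : Type*} [MeasurableSpace X] [NormedAddCommGroup E]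
    {μ : Measure X} [IsFiniteMeasure μ] {p : ℝ≥0∞} (hp : 1 ≤ p) (hp' : p ≠ ∞) {f : ℕ → X → E}
    {s : X → E} {C : ℝ} (hf : ∀ n, AEStronglyMeasurable (f n) μ)
    (hC : ∀ n, ∀ᵐ x ∂μ, ‖f n x‖ ≤ C)
    (hs : ∀ᵐ x ∂μ, Filter.Tendsto (fun n => f n x) Filter.atTop (nhds (s x))) :
    Filter.Tendsto (fun n => eLpNorm (f n - s) p μ) Filter.atTop (nhds 0) := by
  have hsm : AEStronglyMeasurable s μ := aestronglyMeasurable_of_tendsto_ae _ hf hs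
  have hsC : ∀ᵐ x ∂μ, ‖s x‖ ≤ C := by
    filter_upwards [hs, ae_all_iff.2 hC] with x hx hxC
    exact le_of_tendsto hx.norm (Filter.Eventually.of_forall hxC)
  refine tendsto_Lp_finite_of_tendsto_ae hp hp' hf (MemLp.of_bound hsm C hsC) ?_ hs
  refine unifIntegrable_of hp hp' hf fun ε _ => ⟨(C + 1).toNNReal, fun n => ?_⟩
  rw [eLpNorm_congr_ae (g := 0), eLpNorm_zero]
  · exact zero_le
  · filter_upwards [hC n] with x hx
    refine Set.indicator_of_notMem (fun h => ?_) _
    have h1 : (C + 1).toNNReal ≤ ‖f n x‖₊ := h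
    rw [Real.toNNReal_le_iff_le_coe, coe_nnnorm] at h1
    linarith

lemma exists_computes_eLpNorm_sub_le {p : ℝ≥0∞} (hp : 1 ≤ p) (hp' : p ≠ ∞) {m n w : ℕ}
    (hw : 2 ≤ w) (hm : m ≤ w) (hn : n ≤ w) {g : (Fin m → ℝ) → (Fin n → ℝ)}
    (hg : UniformContinuous g) {K : Set (Fin m → ℝ)} (hK : IsCompact K) {ε : ℝ} (hε : 0 < ε) :
    ∃ Φ : (Fin m → ℝ) → (Fin n → ℝ), Computes trueLeakyReLUs {1, w} Φ ∧
      eLpNorm (Φ - g) p (volume.restrict K) ≤ ENNReal.ofReal ε := by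
  set μ : Measure (Fin m → ℝ) := volume.restrict K with hμ
  have : IsFiniteMeasure μ := isFiniteMeasure_restrict.2 hK.measure_lt_top.ne
  have hp0 : 0 < p.toReal := ENNReal.toReal_pos (zero_lt_one.trans_le hp).ne' hp'
  have hM : μ Set.univ ^ p.toReal⁻¹ ≠ ∞ := by finiteness
  set M := (μ Set.univ ^ p.toReal⁻¹).toReal with hMdef
  have hM0 : 0 ≤ M := ENNReal.toReal_nonneg
  obtain ⟨Φ, s, C, hΦ, hC, hlim, hs⟩ := exists_computes_tendsto hw hm hn hg hK
    (show 0 < ε / (2 * (M + 1)) by positivity)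
  have hΦm (l) : AEStronglyMeasurable (Φ l) μ := (hΦ l).continuous.aestronglyMeasurable
  have hlim' : ∀ᵐ x ∂μ, Filter.Tendsto (fun l => Φ l x) Filter.atTop (nhds (s x)) :=
    (ae_restrict_iff' hK.measurableSet).2 hlim
  have hsm : AEStronglyMeasurable s μ := aestronglyMeasurable_of_tendsto_ae _ hΦm hlim'
  have htend := tendsto_eLpNorm_of_norm_le hp hp' hΦm (C := C)
    (fun l => ae_restrict_of_forall_mem hK.measurableSet (hC l)) hlim'
  have hpos : 0 < ENNReal.ofReal (ε / 2) := ENNReal.ofReal_pos.2 (half_pos hε)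
  obtain ⟨l, hl⟩ := (htend.eventually_lt_const hpos).exists
  refine ⟨Φ l, hΦ l, ?_⟩
  have hsg : eLpNorm (s - g) p μ ≤ ENNReal.ofReal (ε / 2) := by
    refine (eLpNorm_le_of_ae_bound (C := ε / (2 * (M + 1)))
      (ae_restrict_of_forall_mem hK.measurableSet hs)).trans ?_
    rw [← ENNReal.ofReal_toReal hM, ← hMdef, ← ENNReal.ofReal_mul hM0]
    refine ENNReal.ofReal_le_ofReal ?_
    rw [mul_div_assoc', div_le_div_iff₀ (by positivity) two_pos]
    nlinarith
  calc eLpNorm (Φ l - g) p μ = eLpNorm ((Φ l - s) + (s - g)) p μ := by rw [sub_add_sub_cancel]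
    _ ≤ eLpNorm (Φ l - s) p μ + eLpNorm (s - g) p μ :=
      eLpNorm_add_le ((hΦm l).sub hsm) (hsm.sub hg.continuous.aestronglyMeasurable) hp
    _ ≤ ENNReal.ofReal (ε / 2) + ENNReal.ofReal (ε / 2) := add_le_add hl.le hsg
    _ = ENNReal.ofReal ε := by
      rw [← ENNReal.ofReal_add (half_pos hε).le (half_pos hε).le, add_halves]

/-- The norms built from the `p`-norm and from the maximum norm on `ℝ^n` are equivalent. -/
lemma lpNormOn_le (p : ℝ≥0∞) [Fact (1 ≤ p)] {m n : ℕ} (X : Set (Fin m → ℝ))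
    (f : (Fin m → ℝ) → (Fin n → ℝ)) :
    lpNormOn p X f ≤ ((n : NNReal) ^ (1 / p).toReal : NNReal) * eLpNorm f p (volume.restrict X) := by
  refine eLpNorm_le_nnreal_smul_eLpNorm_of_ae_le_mul (Filter.Eventually.of_forall fun x => ?_) p
  have := (PiLp.lipschitzWith_toLp p (fun _ : Fin n => ℝ)).dist_le_mul (f x) 0
  rw [WithLp.toLp_zero, dist_zero_right, dist_zero_right, Fintype.card_fin] at this
  exact_mod_cast this

lemma norm_le_norm_toLp (p : ℝ≥0∞) [Fact (1 ≤ p)] {n : ℕ} (y : Fin n → ℝ) :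
    ‖y‖ ≤ ‖WithLp.toLp p y‖ :=
  (pi_norm_le_iff_of_nonneg (norm_nonneg _)).2 fun i => PiLp.norm_apply_le (WithLp.toLp p y) i

theorem exists_fnnWidthDim_lpNormOn_sub_lt (p : ℝ≥0∞) [Fact (1 ≤ p)] (hp : p ≠ ∞) {m n w : ℕ}
    (hw : 2 ≤ w) (hm : m ≤ w) (hn : n ≤ w) {K : Set (Fin m → ℝ)} (hK : IsCompact K)
    {f : (Fin m → ℝ) → (Fin n → ℝ)} (hf : f ∈ lpFunctionsOn p n K) {ε : ℝ} (hε : 0 < ε) :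
    ∃ φ ∈ fnnWidthDim trueLeakyReLUs m n w 1, lpNormOn p K (f - φ) < ENNReal.ofReal ε := by
  have hp1 : 1 ≤ p := Fact.out
  set μ : Measure (Fin m → ℝ) := volume.restrict K with hμ
  have : IsFiniteMeasure μ := isFiniteMeasure_restrict.2 hK.measure_lt_top.ne
  set c : NNReal := (n : NNReal) ^ (1 / p).toReal with hc
  have hfm : MemLp f p μ :=
    MemLp.of_le hf ((PiLp.continuous_ofLp p _).comp_aestronglyMeasurable hf.1)
      (Filter.Eventually.of_forall fun x => norm_le_norm_toLp p (f x))
  have hη : 0 < ε / (2 * (c + 1)) := by positivity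
  set η := ε / (2 * (c + 1)) with hηdef
  set η' := η / 2
  have hη' : 0 < η' := half_pos hη
  obtain ⟨g, hgs, hfg, hgc, -⟩ := hfm.exists_hasCompactSupport_eLpNorm_sub_le hp
    (ENNReal.ofReal_pos.2 hη').ne'
  -- the last activation is `leakyReLU (1 / 2)`, so its inverse is applied to the target
  set τ : (Fin n → ℝ) → (Fin n → ℝ) := fun y i => leakyReLU 2 (y i) with hτ
  have hτc : Continuous τ :=
    continuous_pi fun i => (continuous_leakyReLU 2).comp (continuous_apply i)
  have hτ0 : τ 0 = 0 := by funext i; simp [hτ, leakyReLU]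
  have hg' : UniformContinuous (τ ∘ g) :=
    HasCompactSupport.uniformContinuous_of_continuous (hgs.comp_left hτ0) (hτc.comp hgc)
  obtain ⟨Φ, hΦ, hΦg⟩ := exists_computes_eLpNorm_sub_le hp1 hp hw hm hn hg' hK hη'
  refine ⟨_, hΦ.act_mem_fnnWidthDim (by omega) (a := fun _ => leakyReLU (1 / 2))
    fun _ => leakyReLU_mem (by norm_num) (by norm_num), ?_⟩
  set Ψ : (Fin m → ℝ) → (Fin n → ℝ) := fun x i => leakyReLU (1 / 2) (Φ x i) with hΨ
  have hΨc : Continuous Ψ :=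
    continuous_pi fun i => (continuous_leakyReLU _).comp ((continuous_apply i).comp hΦ.continuous)
  have hgΨ : eLpNorm (g - Ψ) p μ ≤ ENNReal.ofReal η' := by
    refine (eLpNorm_mono fun x => ?_).trans hΦg
    rw [← norm_neg, pi_norm_le_iff_of_nonneg (norm_nonneg _)]
    intro i
    refine le_trans ?_ (norm_le_pi_norm _ i)
    have := abs_leakyReLU_sub_le (a := 1 / 2) (by norm_num) (by norm_num) (Φ x i)
      (leakyReLU 2 (g x i))
    rw [leakyReLU_leakyReLU _ two_pos, show (1 / 2 : ℝ) * 2 = 1 by norm_num,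
      leakyReLU_one] at this
    simpa [hΨ] using this
  have hfΨ : eLpNorm (f - Ψ) p μ ≤ ENNReal.ofReal η := by
    rw [← sub_add_sub_cancel f g Ψ]
    refine (eLpNorm_add_le (hfm.1.sub hgc.aestronglyMeasurable)
      (hgc.sub hΨc).aestronglyMeasurable hp1).trans ((add_le_add hfg hgΨ).trans_eq ?_)
    rw [← ENNReal.ofReal_add hη'.le hη'.le, add_halves]
  calc lpNormOn p K (f - Ψ) ≤ c * eLpNorm (f - Ψ) p μ := lpNormOn_le p K _
    _ ≤ c * ENNReal.ofReal η := by gcongr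
    _ = ENNReal.ofReal (c * η) := by
      rw [ENNReal.ofReal_mul c.coe_nonneg, ENNReal.ofReal_coe_nnreal]
    _ < ENNReal.ofReal ε := by
      refine (ENNReal.ofReal_lt_ofReal_iff hε).2 ?_
      have hc0 : (0 : ℝ) ≤ c := c.coe_nonneg
      rw [hηdef, mul_div_assoc', div_lt_iff₀ (by positivity)]
      nlinarith

/-! ### Lower bounds -/

lemma FNN.le_width_of_mem_hiddenDims {A : Set (ℝ → ℝ)} {m n : ℕ} (φ : FNN A m n) {d : ℕ}
    (hd : d ∈ φ.hiddenDims) : d ≤ φ.width := by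
  obtain ⟨a, ha⟩ : ∃ a, φ.hiddenDims.max? = some a := by
    rw [← Option.isSome_iff_exists, List.isSome_max?_iff]
    exact List.ne_nil_of_mem hd
  rw [FNN.width, ha, Option.getD_some]
  exact (List.max?_eq_some_iff.1 ha).2 d hd

lemma FNN.pos_of_mem_hiddenDims {A : Set (ℝ → ℝ)} {m n : ℕ} (φ : FNN A m n) {d : ℕ}
    (hd : d ∈ φ.hiddenDims) : 0 < d := by
  induction φ with
  | single L => simp [FNN.hiddenDims] at hd
  | snoc φ hk L ih =>
    rcases List.mem_append.1 hd with h | h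
    · exact ih h
    · rwa [List.mem_singleton.1 h]

lemma FNN.minInteriorDim_pos {A : Set (ℝ → ℝ)} {m n : ℕ} (hm : 0 < m) (hn : 0 < n)
    (φ : FNN A m n) : 0 < φ.minInteriorDim := by
  rw [FNN.minInteriorDim]
  cases h : φ.hiddenDims.min? with
  | none => simp [hm, hn]
  | some a => exact φ.pos_of_mem_hiddenDims (List.min?_eq_some_iff.1 h).1

lemma continuous_of_mem_fnnWidthLE {m n w : ℕ} {f : (Fin m → ℝ) → (Fin n → ℝ)}
    (hf : f ∈ fnnWidthLE trueLeakyReLUs m n w) : Continuous f := by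
  obtain ⟨φ, -, rfl⟩ := hf
  exact φ.continuous_eval fun _ => continuous_of_mem_trueLeakyReLUs

/-- Universal approximation implies approximation in measure of bounded functions on compacts. -/
lemma IsLpUniversalApproximator.exists_volume_lt {p : ℝ≥0∞} [Fact (1 ≤ p)] (hp : p ≠ ∞)
    {m n : ℕ} {M : Set ((Fin m → ℝ) → (Fin n → ℝ))}
    (hM : IsLpUniversalApproximator p M (lpFunctionsOn p n Set.univ))
    (hMc : ∀ f ∈ M, Continuous f) {g : (Fin m → ℝ) → (Fin n → ℝ)} (hg : Measurable g) {C : ℝ}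
    (hC : ∀ x, ‖g x‖ ≤ C) {K : Set (Fin m → ℝ)} (hK : IsCompact K) {ε : ℝ} (hε : 0 < ε) :
    ∃ f ∈ M, volume {x ∈ K | 1 ≤ ‖f x - g x‖} < ENNReal.ofReal ε := by
  have hp1 : 1 ≤ p := Fact.out
  have hp00 : p ≠ 0 := (zero_lt_one.trans_le hp1).ne'
  have hp0 : 0 < p.toReal := ENNReal.toReal_pos hp00 hp
  have : IsFiniteMeasure ((volume : Measure (Fin m → ℝ)).restrict K) :=
    isFiniteMeasure_restrict.2 hK.measure_lt_top.ne
  have hto : Continuous (WithLp.toLp p : (Fin n → ℝ) → _) := PiLp.continuous_toLp p _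
  have hind : Measurable (K.indicator g) := hg.indicator hK.measurableSet
  have hmem : K.indicator g ∈ lpFunctionsOn p n Set.univ := by
    have heq : (fun x => WithLp.toLp p (K.indicator g x))
        = K.indicator fun x => WithLp.toLp p (g x) := by
      funext x
      by_cases hx : x ∈ K <;> simp [hx]
    rw [lpFunctionsOn, Set.mem_ofPred_eq, Measure.restrict_univ, heq,
      memLp_indicator_iff_restrict hK.measurableSet]
    refine MemLp.of_bound (hto.comp_aestronglyMeasurable hg.aestronglyMeasurable)
      (((n : NNReal) ^ (1 / p).toReal : NNReal) * C) (Filter.Eventually.of_forall fun x => ?_)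
    have := (PiLp.lipschitzWith_toLp p (fun _ : Fin n => ℝ)).dist_le_mul (g x) 0
    rw [WithLp.toLp_zero, dist_zero_right, dist_zero_right, Fintype.card_fin] at this
    exact this.trans (by gcongr; exact hC x)
  obtain ⟨f, hfM, hf⟩ := hM _ hmem K hK (ε ^ p.toReal⁻¹) (by positivity)
  refine ⟨f, hfM, ?_⟩
  have hcheb := meas_ge_le_mul_pow_eLpNorm_enorm (volume.restrict K) hp00 hp
    (f := fun x => WithLp.toLp p ((f - K.indicator g) x))
    (hto.comp_aestronglyMeasurable
      ((hMc f hfM).measurable.sub hind).aestronglyMeasurable) one_ne_zero (by simp)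
  rw [inv_one, ENNReal.one_rpow, one_mul, Measure.restrict_apply' hK.measurableSet] at hcheb
  calc volume {x ∈ K | 1 ≤ ‖f x - g x‖}
      ≤ volume ({x | 1 ≤ ‖WithLp.toLp p ((f - K.indicator g) x)‖ₑ} ∩ K) := by
        refine measure_mono fun x hx => ⟨?_, hx.1⟩
        have h1 := hx.2.trans (norm_le_norm_toLp p (f x - g x))
        rw [Set.mem_ofPred_eq, Pi.sub_apply, Set.indicator_of_mem hx.1, ← ofReal_norm]
        simpa using ENNReal.ofReal_le_ofReal h1
    _ ≤ _ := hcheb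
    _ < ENNReal.ofReal (ε ^ p.toReal⁻¹) ^ p.toReal := ENNReal.rpow_lt_rpow hf hp0
    _ = ENNReal.ofReal ε := by
        rw [ENNReal.ofReal_rpow_of_pos (by positivity), ← Real.rpow_mul hε.le,
          inv_mul_cancel₀ hp0.ne', Real.rpow_one]

/-- Any finite sequence of values is nearly attained, each on its own slab. -/
lemma IsLpUniversalApproximator.exists_near_values {p : ℝ≥0∞} [Fact (1 ≤ p)] (hp : p ≠ ∞)
    {m n : ℕ} {M : Set ((Fin m → ℝ) → (Fin n → ℝ))}
    (hM : IsLpUniversalApproximator p M (lpFunctionsOn p n Set.univ))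
    (hMc : ∀ f ∈ M, Continuous f) (i₀ : Fin m) (N : ℕ) (v : ℕ → Fin n → ℝ) :
    ∃ f ∈ M, ∀ k < N, ∃ x : Fin m → ℝ, (k : ℝ) ≤ x i₀ ∧ x i₀ < k + 1 ∧
      ∀ i, |f x i - v k i| < 1 := by
  set v' : ℕ → Fin n → ℝ := fun k => if k < N then v k else 0 with hv'
  have hbound (k : ℕ) : ‖v' k‖ ≤ ∑ k ∈ Finset.range N, ‖v k‖ := by
    by_cases hk : k < N
    · simp only [hv', hk, if_true]
      exact Finset.single_le_sum (f := fun k => ‖v k‖) (fun _ _ => norm_nonneg _)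
        (Finset.mem_range.2 hk)
    · simp only [hv', hk, if_false, norm_zero]
      exact Finset.sum_nonneg fun _ _ => norm_nonneg _
  obtain ⟨f, hfM, hf⟩ := hM.exists_volume_lt hp hMc (g := fun x => v' ⌊x i₀⌋₊)
    ((measurable_from_nat (f := v')).comp (Nat.measurable_floor.comp (measurable_pi_apply i₀)))
    (fun x => hbound _) (isCompact_Icc (a := (0 : Fin m → ℝ)) (b := fun _ => (N : ℝ))) one_pos
  refine ⟨f, hfM, fun k hk => ?_⟩
  by_contra! hcon
  refine absurd hf (not_lt.2 ?_)
  have hcube : volume (Set.pi Set.univ fun j : Fin m =>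
      if j = i₀ then Set.Ico (k : ℝ) (k + 1) else Set.Ico (0 : ℝ) 1) = 1 := by
    rw [volume_pi_pi]
    refine Finset.prod_eq_one fun j _ => ?_
    split_ifs <;> simp
  rw [ENNReal.ofReal_one, ← hcube]
  refine measure_mono fun x hx => ?_
  have hx0 : x i₀ ∈ Set.Ico (k : ℝ) (k + 1) := by simpa using hx i₀ trivial
  have hkN : (k : ℝ) + 1 ≤ N := by exact_mod_cast hk
  have hxj (j) : 0 ≤ x j ∧ x j ≤ N := by
    have := hx j trivial
    have hk0 : (0 : ℝ) ≤ k := k.cast_nonneg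
    by_cases hj : j = i₀
    · subst hj; exact ⟨hk0.trans hx0.1, hx0.2.le.trans hkN⟩
    · simp only [hj, if_false] at this
      exact ⟨this.1, by linarith [this.2]⟩
  refine ⟨⟨fun j => (hxj j).1, fun j => (hxj j).2⟩, ?_⟩
  obtain ⟨i, hi⟩ := hcon x hx0.1 hx0.2
  have hfl : ⌊x i₀⌋₊ = k := (Nat.floor_eq_iff (hxj i₀).1).2 hx0
  simp only [hfl, hv', hk, if_true]
  exact hi.trans (norm_le_pi_norm (f x - v k) i)

/-- A network whose layers all have dimension less than `m` is constant in some direction. -/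
lemma FNN.exists_eval_add_smul {A : Set (ℝ → ℝ)} {m n : ℕ} (φ : FNN A m n)
    (h : ∀ d ∈ φ.hiddenDims, d < m) (hn : n < m) :
    ∃ u : Fin m → ℝ, u ≠ 0 ∧ ∀ (c : ℝ) x, φ.eval (x + c • u) = φ.eval x := by
  induction φ with
  | single L =>
    have hker := LinearMap.ker_ne_bot_of_finrank_lt (f := L.weight.mulVecLin) (by simpa using hn)
    obtain ⟨u, hu, hu0⟩ := (Submodule.ne_bot_iff _).1 hker
    refine ⟨u, hu0, fun c x => ?_⟩
    have hu' : L.weight *ᵥ u = 0 := by simpa using hu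
    simp only [FNN.eval]
    funext i
    rw [Layer.eval_apply, Layer.eval_apply, Matrix.mulVec_add, Matrix.mulVec_smul, hu', smul_zero,
      add_zero]
  | snoc φ hk L ih =>
    obtain ⟨u, hu0, hu⟩ := ih (fun d hd => h d (List.mem_append_left _ hd))
      (h _ (List.mem_append_right _ (List.mem_singleton_self _)))
    exact ⟨u, hu0, fun c x => by simp only [FNN.eval, hu]⟩

/-- A function that is constant along a line direction cannot be close in measure to `2` on a ball
and to `0` on a disjoint translate of that ball. -/
lemma le_width_of_isLpUniversalApproximator_left {p : ℝ≥0∞} [Fact (1 ≤ p)] (hp : p ≠ ∞)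
    {m n w : ℕ} (hn : 0 < n) (h : IsLpUniversalApproximator p (fnnWidthLE trueLeakyReLUs m n w)
      (lpFunctionsOn p n Set.univ)) : m ≤ w := by
  by_contra! hw
  set B : Set (Fin m → ℝ) := Metric.ball 0 1 with hB
  have hBpos : 0 < volume B := Metric.isOpen_ball.measure_pos volume ⟨0, by simp⟩
  have hBfin : volume B ≠ ∞ := measure_ball_lt_top.ne
  have hε : 0 < (volume B).toReal / 2 := half_pos (ENNReal.toReal_pos hBpos.ne' hBfin)
  obtain ⟨f, hf, hlt⟩ := h.exists_volume_lt hp (fun f hf => continuous_of_mem_fnnWidthLE hf)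
    (g := B.indicator fun _ _ => 2) (measurable_const.indicator Metric.isOpen_ball.measurableSet)
    (C := 2) (fun x => (norm_indicator_le_norm_self _ x).trans
      ((pi_norm_le_iff_of_nonneg zero_le_two).2 fun i => by simp))
    (isCompact_closedBall (0 : Fin m → ℝ) 4) hε
  obtain ⟨φ, hφ, rfl⟩ := hf
  obtain ⟨u, hu0, hu⟩ : ∃ u : Fin m → ℝ, u ≠ 0 ∧ ∀ (c : ℝ) x, φ.eval (x + c • u) = φ.eval x := by
    cases φ with
    | single L =>
      have h1 : max m n ≤ w := hφ
      omega
    | snoc φ hk L =>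
      have hd (d) (hd : d ∈ φ.hiddenDims ++ [_]) : d < m :=
        ((FNN.snoc φ hk L).le_width_of_mem_hiddenDims hd).trans_lt (hφ.trans_lt hw)
      obtain ⟨u, hu0, hu⟩ := φ.exists_eval_add_smul
        (fun d h => hd d (List.mem_append_left _ h)) (hd _ (by simp))
      exact ⟨u, hu0, fun c x => by simp only [FNN.eval, hu]⟩
  -- normalize the direction so that the translate of `B` stays in the ball of radius `4`
  obtain ⟨z, hz, hzφ⟩ : ∃ z : Fin m → ℝ, ‖z‖ = 3 ∧ ∀ x, φ.eval (x + z) = φ.eval x := by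
    refine ⟨(3 / ‖u‖) • u, ?_, hu _⟩
    have : 0 < ‖u‖ := norm_pos_iff.2 hu0
    rw [norm_smul, Real.norm_eq_abs, abs_of_pos (by positivity)]
    field_simp
  set S := {x ∈ Metric.closedBall (0 : Fin m → ℝ) 4 |
    1 ≤ ‖φ.eval x - B.indicator (fun _ _ => 2) x‖} with hS
  have hcover : B ⊆ S ∪ (fun x => x + z) ⁻¹' S := by
    intro x hx
    have hx1 : ‖x‖ < 1 := by simpa [hB] using hx
    by_contra hcon
    rw [Set.mem_union, not_or] at hcon
    have h1 : ‖φ.eval x - fun _ => 2‖ < 1 := by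
      by_contra! h1
      refine hcon.1 ⟨by simp; linarith, ?_⟩
      rwa [Set.indicator_of_mem hx]
    have h2 : ‖φ.eval x‖ < 1 := by
      by_contra! h2
      have hxz := norm_add_le x z
      have hxz' := norm_sub_norm_le z (-x)
      rw [norm_neg, sub_neg_eq_add, add_comm z] at hxz'
      refine hcon.2 ⟨by simp; linarith, ?_⟩
      rwa [hzφ, Set.indicator_of_notMem (by simp [hB]; linarith), sub_zero]
    have h3 := (norm_le_pi_norm _ (⟨0, hn⟩ : Fin n)).trans_lt h1
    have h4 := (norm_le_pi_norm _ (⟨0, hn⟩ : Fin n)).trans_lt h2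
    rw [Real.norm_eq_abs, abs_lt] at h3 h4
    simp only [Pi.sub_apply] at h3
    linarith [h3.1, h4.2]
  have hle := (measure_mono (μ := volume) hcover).trans (measure_union_le _ _)
  rw [measure_preimage_add_right] at hle
  refine absurd (hle.trans_lt (ENNReal.add_lt_add hlt hlt)) (not_lt.2 ?_)
  rw [← ENNReal.ofReal_add hε.le hε.le, add_halves, ENNReal.ofReal_toReal hBfin]

/-- The preactivations of the last layer lie in a hyperplane with normal vector `c`. As
activations are increasing, two outputs cannot differ strictly by the signs of `c` in every
coordinate. -/
lemma le_width_of_isLpUniversalApproximator_right {p : ℝ≥0∞} [Fact (1 ≤ p)] (hp : p ≠ ∞)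
    {m n w : ℕ} (hm : 0 < m) (h : IsLpUniversalApproximator p (fnnWidthLE trueLeakyReLUs m n w)
      (lpFunctionsOn p n Set.univ)) : n ≤ w := by
  by_contra! hw
  -- the values are all vectors with coordinates `2` and `-2`
  let e : (Fin n → Bool) ≃ Fin _ := Fintype.equivFin (Fin n → Bool)
  obtain ⟨f, hf, hlt⟩ := h.exists_near_values hp (fun f hf => continuous_of_mem_fnnWidthLE hf)
    ⟨0, hm⟩ (Fintype.card (Fin n → Bool))
    (fun k i => if hk : k < Fintype.card (Fin n → Bool) then
      (if e.symm ⟨k, hk⟩ i then 2 else -2) else 0)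
  have hsign (s : Fin n → Bool) : ∃ x, ∀ i, |f x i - if s i then 2 else -2| < 1 := by
    obtain ⟨x, -, -, hx⟩ := hlt (e s) (e s).2
    refine ⟨x, fun i => ?_⟩
    have := hx i
    rwa [dif_pos (e s).2, Fin.eta, e.symm_apply_apply] at this
  obtain ⟨φ, hφ, rfl⟩ := hf
  cases φ with
  | single L =>
    have h1 : max m n ≤ w := hφ
    omega
  | @snoc k _ φ hk L =>
    have hkn : k < n :=
      ((FNN.snoc φ hk L).le_width_of_mem_hiddenDims (d := k) (by simp [FNN.hiddenDims])).trans_lt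
        (hφ.trans_lt hw)
    obtain ⟨c, hc, hc0⟩ := (Submodule.ne_bot_iff _).1
      (LinearMap.ker_ne_bot_of_finrank_lt (f := L.weightᵀ.mulVecLin) (by simpa using hkn))
    have hc' : c ᵥ* L.weight = 0 := by simpa [Matrix.mulVec_transpose] using hc
    obtain ⟨x, hx⟩ := hsign fun i => decide (0 ≤ c i)
    obtain ⟨y, hy⟩ := hsign fun i => decide (c i < 0)
    set X := L.weight *ᵥ φ.eval x + L.bias with hX
    set Y := L.weight *ᵥ φ.eval y + L.bias with hY
    have hXY : c ⬝ᵥ X = c ⬝ᵥ Y := by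
      simp only [hX, hY, dotProduct_add, Matrix.dotProduct_mulVec, hc', zero_dotProduct]
    have hmono (i) {a b : ℝ} (hab : L.act i a < L.act i b) : a < b :=
      (strictMono_of_mem_trueLeakyReLUs (L.act_mem i)).lt_iff_lt.1 hab
    have hpos (i) : c i * Y i ≤ c i * X i ∧ (c i ≠ 0 → c i * Y i < c i * X i) := by
      have h1 : |L.act i (X i) - if decide (0 ≤ c i) then 2 else -2| < 1 := hx i
      have h2 : |L.act i (Y i) - if decide (c i < 0) then 2 else -2| < 1 := hy i
      simp only [decide_eq_true_eq] at h1 h2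
      rcases le_or_gt 0 (c i) with hci | hci
      · rw [if_pos hci, abs_lt] at h1
        rw [if_neg (not_lt.2 hci), abs_lt] at h2
        have := hmono i (show L.act i (Y i) < L.act i (X i) by linarith)
        exact ⟨mul_le_mul_of_nonneg_left this.le hci,
          fun hne => mul_lt_mul_of_pos_left this (hci.lt_of_ne' hne)⟩
      · rw [if_neg (not_le.2 hci), abs_lt] at h1
        rw [if_pos hci, abs_lt] at h2
        have := hmono i (show L.act i (X i) < L.act i (Y i) by linarith)
        exact ⟨(mul_lt_mul_of_neg_left this hci).le, fun _ => mul_lt_mul_of_neg_left this hci⟩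
    obtain ⟨i, hi⟩ := Function.ne_iff.1 hc0
    refine hXY.not_gt ?_
    exact Finset.sum_lt_sum (fun i _ => (hpos i).1) ⟨i, Finset.mem_univ i, (hpos i).2 hi⟩

lemma Layer.monotone_or_antitone_eval (L : Layer trueLeakyReLUs 1 1) :
    Monotone L.eval ∨ Antitone L.eval := by
  have key (x : Fin 1 → ℝ) (i : Fin 1) :
      L.eval x i = L.act i (L.weight i 0 * x 0 + L.bias i) := by
    simp [Layer.eval, Matrix.mulVec, dotProduct]
  rcases le_total 0 (L.weight 0 0) with hw | hw
  · refine Or.inl fun x y hxy i => ?_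
    rw [key, key]
    refine (strictMono_of_mem_trueLeakyReLUs (L.act_mem i)).monotone ?_
    rw [Subsingleton.elim i 0]
    have := mul_le_mul_of_nonneg_left (hxy 0) hw
    linarith
  · refine Or.inr fun x y hxy i => ?_
    rw [key, key]
    refine (strictMono_of_mem_trueLeakyReLUs (L.act_mem i)).monotone ?_
    rw [Subsingleton.elim i 0]
    have := mul_le_mul_of_nonpos_left (hxy 0) hw
    linarith

lemma FNN.monotone_or_antitone_eval {n : ℕ} (φ : FNN trueLeakyReLUs 1 n) (hn : n = 1)
    (h : ∀ d ∈ φ.hiddenDims, d = 1) : Monotone φ.eval ∨ Antitone φ.eval := by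
  induction φ with
  | single L => subst hn; exact L.monotone_or_antitone_eval
  | @snoc k _ φ hk L ih =>
    obtain rfl : k = 1 := h k (by simp [FNN.hiddenDims])
    subst hn
    have ih' := ih rfl fun d hd => h d (List.mem_append_left _ hd)
    rcases ih' with h1 | h1 <;> rcases L.monotone_or_antitone_eval with h2 | h2
    · exact Or.inl (h2.comp h1)
    · exact Or.inr (h2.comp_monotone h1)
    · exact Or.inr (h2.comp_antitone h1)
    · exact Or.inl (h2.comp h1)

/-- Networks of width `1` from `ℝ` to `ℝ` are monotone or antitone, so they cannot nearly attain
the values `0, 2, 0` in this order. -/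
lemma two_le_width_of_isLpUniversalApproximator {p : ℝ≥0∞} [Fact (1 ≤ p)] (hp : p ≠ ∞)
    {m n w : ℕ} (hm : 0 < m) (hn : 0 < n)
    (h : IsLpUniversalApproximator p (fnnWidthLE trueLeakyReLUs m n w)
      (lpFunctionsOn p n Set.univ)) : 2 ≤ w := by
  by_contra! hw
  have hmw := le_width_of_isLpUniversalApproximator_left hp hn h
  have hnw := le_width_of_isLpUniversalApproximator_right hp hm h
  obtain rfl : m = 1 := by omega
  obtain rfl : n = 1 := by omega
  obtain ⟨f, hf, hlt⟩ := h.exists_near_values hp (fun f hf => continuous_of_mem_fnnWidthLE hf)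
    0 3 (fun k _ => if k = 1 then 2 else 0)
  obtain ⟨φ, hφ, rfl⟩ := hf
  have hmono : Monotone φ.eval ∨ Antitone φ.eval := by
    refine φ.monotone_or_antitone_eval rfl fun d hd => ?_
    have h1 := φ.le_width_of_mem_hiddenDims hd
    have h2 := φ.pos_of_mem_hiddenDims hd
    omega
  obtain ⟨x, -, hx, hxv⟩ := hlt 0 (by norm_num)
  obtain ⟨y, hy, hy', hyv⟩ := hlt 1 (by norm_num)
  obtain ⟨z, hz, -, hzv⟩ := hlt 2 (by norm_num)
  have hxy : x ≤ y := fun i => by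
    rw [Subsingleton.elim i 0]; norm_num at hx hy; linarith
  have hyz : y ≤ z := fun i => by
    rw [Subsingleton.elim i 0]; norm_num at hy' hz; linarith
  have h0 := abs_lt.1 (hxv 0)
  have h1 := abs_lt.1 (hyv 0)
  have h2 := abs_lt.1 (hzv 0)
  norm_num at h0 h1 h2
  rcases hmono with hm | hm
  · linarith [hm hyz 0, h1.1, h2.2]
  · linarith [hm hxy 0, h1.1, h0.2]

theorem theorem1 (p : ℝ≥0∞) [Fact (1 ≤ p)] (hp : p ≠ ∞) (dx dy : ℕ) (hdx : 0 < dx)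
    (hdy : 0 < dy) :
    IsLpUniversalApproximator p (fnnWidthDim trueLeakyReLUs dx dy (max 2 (max dx dy)) 1)
      (lpFunctionsOn p dy (Set.univ : Set (Fin dx → ℝ))) ∧
    (∀ K : Set (Fin dx → ℝ), IsCompact K → ∀ f ∈ lpFunctionsOn p dy K, ∀ ε : ℝ, 0 < ε →
      ∃ φ ∈ fnnWidthDim trueLeakyReLUs dx dy (max 2 (max dx dy)) 1,
        lpNormOn p K (f - φ) < ENNReal.ofReal ε) ∧
    IsLeast {w : ℕ | IsLpUniversalApproximator p (fnnWidthLE trueLeakyReLUs dx dy w)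
      (lpFunctionsOn p dy (Set.univ : Set (Fin dx → ℝ)))} (max 2 (max dx dy)) ∧
    IsLeast {k : ℕ | IsLpUniversalApproximator p
      (fnnWidthDim trueLeakyReLUs dx dy (max 2 (max dx dy)) k)
      (lpFunctionsOn p dy (Set.univ : Set (Fin dx → ℝ)))} 1 := by
  have hlocal : ∀ K : Set (Fin dx → ℝ), IsCompact K → ∀ f ∈ lpFunctionsOn p dy K, ∀ ε : ℝ,
      0 < ε → ∃ φ ∈ fnnWidthDim trueLeakyReLUs dx dy (max 2 (max dx dy)) 1,
        lpNormOn p K (f - φ) < ENNReal.ofReal ε := fun K hK f hf ε hε =>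
    exists_fnnWidthDim_lpNormOn_sub_lt p hp (by omega) (by omega) (by omega) hK hf hε
  have hglobal : IsLpUniversalApproximator p
      (fnnWidthDim trueLeakyReLUs dx dy (max 2 (max dx dy)) 1)
      (lpFunctionsOn p dy (Set.univ : Set (Fin dx → ℝ))) := by
    intro g hg K hK ε hε
    have hgK : g ∈ lpFunctionsOn p dy K :=
      MemLp.mono_measure (Measure.restrict_mono (Set.subset_univ K) le_rfl) hg
    obtain ⟨φ, hφ, hlt⟩ := hlocal K hK g hgK ε hε
    refine ⟨φ, hφ, lt_of_eq_of_lt ?_ hlt⟩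
    refine eLpNorm_congr_norm_ae (Filter.Eventually.of_forall fun x => ?_)
    simp only [Pi.sub_apply, WithLp.toLp_sub]
    exact norm_sub_rev _ _
  refine ⟨hglobal, hlocal, ⟨?_, fun w hw => ?_⟩, hglobal, fun k hk => ?_⟩
  · intro g hg K hK ε hε
    obtain ⟨f, ⟨φ, hφ, -, rfl⟩, hlt⟩ := hglobal g hg K hK ε hε
    exact ⟨_, ⟨φ, hφ.le, rfl⟩, hlt⟩
  · exact max_le (two_le_width_of_isLpUniversalApproximator hp hdx hdy hw)
      (max_le (le_width_of_isLpUniversalApproximator_left hp hdy hw)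
        (le_width_of_isLpUniversalApproximator_right hp hdx hw))
  · -- interior dimensions are positive, so for `k = 0` there are no networks at all
    obtain ⟨f, ⟨φ, -, rfl, -⟩, -⟩ := hk 0
      (show MemLp _ _ _ by simp) ∅ isCompact_empty 1 one_pos
    exact φ.minInteriorDim_pos hdx hdy
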